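/- Let $p\ge 1$, let $G=(V,E)$ be an undirected graph on $V=\{1,\dots,p\}$, let $\delta>0$ and let $D\in\mathbb R^{p\times p}$ be symmetric positive definite. Let $\mathbb P_G$ be the set of symmetric positive definite matrices $Q\in\mathbb R^{p\times p}$ with $Q_{ij}=0$ for all $i\neq j$ that are not adjacent in $G$, and let $\mathcal W_G(\delta,D)$ be the probability distribution on $\mathbb P_G$ whose density with respect to Lebesgue measure on the $p+|E|$ free entries of $Q$ is proportional to $$|Q|^{\delta/2-1}\exp\{-\tfrac12\operatorname{tr}(QD)\}\,\mathbb I(Q\in\mathbb P_G).$$ Assume that the numbering $1,\dots,p$ of the nodes is perfect, that is, for every node $i$ the neighbours $j<i$ of $i$ form a clique. Then $\mathcal W_G(\delta,D)$ is well defined (the normalising constant is finite and positive). Split $Q$ and $D$ by their last row and column: $Q_{11}=[Q_{ij}]_{i,j<p}$, $q_{12}=[Q_{ip}]_{i<p}$, $q_{22}=Q_{pp}$, and $D_{11},d_{12},d_{22}$ likewise. Let $\partial p$ be the set of neighbours of node $p$, let $\tilde q_{12},\tilde d_{12}$ be the subvectors of $q_{12},d_{12}$ with indices in $\partial p$, let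 $\tilde D_{11}$ be the submatrix of $D_{11}$ with rows and columns in $\partial p$, let $G_{\{1,\dots,p-1\}}$ be the subgraph of $G$ induced by $\{1,\dots,p-1\}$, and let $Q_{11}^\star=Q_{11}-q_{12}q_{12}^T/q_{22}$. If $Q\sim\mathcal W_G(\delta,D)$, then: 1. $Q_{11}^\star$ is independent of $(q_{12},q_{22})$, and $Q_{11}^\star\sim\mathcal W_{G_{\{1,\dots,p-1\}}}(\delta,D_{11})$. 2. $q_{22}$ is gamma distributed with shape $\frac{\delta+|\partial p|}{2}$ and rate $\frac12\bigl(d_{22}-\tilde d_{12}^T\tilde D_{11}^{-1}\tilde d_{12}\bigr)>0$. 3. The conditional distribution of $\tilde q_{12}$ given $q_{22}$ is $N\bigl(-q_{22}\tilde D_{11}^{-1}\tilde d_{12},\;q_{22}\tilde D_{11}^{-1}\bigr)$. Consequently the following procedure returns a matrix distributed exactly as $\mathcal W_G(\delta,D)$. Step 1: draw $q_{22}$ from the gamma distribution in 2, then $\tilde q_{12}$ from the Gaussian distribution in 3, and obtain $q_{12}$ by setting its entries outside $\partial p$ to zero. Step 2: independently draw $Q_{11}^\star\sim\mathcal W_{G_{\{1,\dots,p-1\}}}(\delta,D_{11})$.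 Step 3: set $Q_{11}=Q_{11}^\star+q_{12}q_{12}^T/q_{22}$ and put $Q_{11},q_{12},q_{22}$ together to form $Q$. The same is true of the recursive procedure that, for $p\ge 2$, carries out Step 2 by applying the procedure itself to $G_{\{1,\dots,p-1\}}$, $\delta$ and $D_{11}$, and that for $p=1$ draws the scalar $Q$ from the gamma distribution with shape $\delta/2$ and rate $D/2$. (For $p=1$ the objects indexed by $\{1,\dots,p-1\}$ are empty, and the only distribution on the $0\times0$ matrix is the point mass.) -/

import Mathlib

open MeasureTheory ProbabilityTheory

noncomputable section

namespace GWishart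

/-- Matrices carry the product (that is, the Borel) σ-algebra. -/
instance {m n : Type*} : MeasurableSpace (Matrix m n ℝ) :=
  inferInstanceAs (MeasurableSpace (m → n → ℝ))

/-- The set `P_G` of symmetric positive definite real matrices indexed by the nodes of `G` whose
off-diagonal entries vanish outside the edges of `G`. (`Matrix.PosDef` includes symmetry.) -/
def precisionCone {V : Type*} (G : SimpleGraph V) : Set (Matrix V V ℝ) :=
  {Q | Q.PosDef ∧ ∀ i j, i ≠ j → ¬ G.Adj i j → Q i j = 0}

/-- Index type of the `p + |E|` free parameters of a matrix in `P_G`: one for every node (the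
diagonal entries) and one for every edge (the off-diagonal entries). -/
def FreeParam {V : Type*} (G : SimpleGraph V) : Type _ := V ⊕ G.edgeSet

instance {V : Type*} [Finite V] (G : SimpleGraph V) : Finite (FreeParam G) :=
  inferInstanceAs (Finite (V ⊕ G.edgeSet))

instance {V : Type*} [Finite V] (G : SimpleGraph V) : Fintype (FreeParam G) :=
  Fintype.ofFinite _

open Classical in
/-- The symmetric matrix with the given free parameters, zero outside the diagonal and the edges. -/
def toMatrix {V : Type*} [DecidableEq V] (G : SimpleGraph V) (x : FreeParam G → ℝ) : Matrix V V ℝ :=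
  Matrix.of fun i j =>
    if i = j then x (Sum.inl i)
    else if h : G.Adj i j then x (Sum.inr ⟨s(i, j), h⟩)
    else 0

/-- The unnormalised density `|Q|^{δ/2-1} exp(-tr(QD)/2) 1(Q ∈ P_G)`. -/
def density {V : Type*} [Fintype V] [DecidableEq V] (G : SimpleGraph V) (δ : ℝ)
    (D Q : Matrix V V ℝ) : ENNReal :=
  (precisionCone G).indicator
    (fun Q => ENNReal.ofReal (Q.det ^ (δ / 2 - 1) * Real.exp (-(1 / 2) * (Q * D).trace))) Q

/-- The measure on matrices whose density with respect to Lebesgue measure on the free parameters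
is `|Q|^{δ/2-1} exp(-tr(QD)/2) 1(Q ∈ P_G)`. -/
def unnormalized {V : Type*} [Fintype V] [DecidableEq V] (G : SimpleGraph V) (δ : ℝ)
    (D : Matrix V V ℝ) : Measure (Matrix V V ℝ) :=
  ((volume : Measure (FreeParam G → ℝ)).withDensity fun x => density G δ D (toMatrix G x)).map
    (toMatrix G)

/-- The G-Wishart distribution `W_G(δ, D)`: the previous measure divided by its total mass. -/
def gWishart {V : Type*} [Fintype V] [DecidableEq V] (G : SimpleGraph V) (δ : ℝ)
    (D : Matrix V V ℝ) : Measure (Matrix V V ℝ) :=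
  (unnormalized G δ D Set.univ)⁻¹ • unnormalized G δ D

/-- The numbering `1, …, p` of the nodes is perfect: for each node, its neighbours with a lower
number form a clique. -/
def IsPerfectlyOrdered {p : ℕ} (G : SimpleGraph (Fin p)) : Prop :=
  ∀ i, G.IsClique {j | G.Adj i j ∧ j < i}

section LastNode

variable {n : ℕ}

/-- The subgraph induced by all nodes but the last one. -/
def dropLast (G : SimpleGraph (Fin (n + 1))) : SimpleGraph (Fin n) :=
  G.comap Fin.castSucc

/-- The block of a matrix with the last row and the last column removed. -/
def block11 (M : Matrix (Fin (n + 1)) (Fin (n + 1)) ℝ) : Matrix (Fin n) (Fin n) ℝ :=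
  M.submatrix Fin.castSucc Fin.castSucc

/-- The last column without its last entry. -/
def block12 (M : Matrix (Fin (n + 1)) (Fin (n + 1)) ℝ) : Fin n → ℝ :=
  fun i => M i.castSucc (Fin.last n)

/-- The last diagonal entry. -/
def block22 (M : Matrix (Fin (n + 1)) (Fin (n + 1)) ℝ) : ℝ :=
  M (Fin.last n) (Fin.last n)

/-- The Schur complement `Q₁₁ - q₁₂ q₁₂ᵀ / q₂₂`. -/
def schur11 (Q : Matrix (Fin (n + 1)) (Fin (n + 1)) ℝ) : Matrix (Fin n) (Fin n) ℝ :=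
  block11 Q - (block22 Q)⁻¹ • Matrix.vecMulVec (block12 Q) (block12 Q)

/-- The set `∂p` of neighbours of the last node, as a type. -/
def LastNbr (G : SimpleGraph (Fin (n + 1))) : Type :=
  {i : Fin n // G.Adj i.castSucc (Fin.last n)}

instance (G : SimpleGraph (Fin (n + 1))) : Finite (LastNbr G) :=
  inferInstanceAs (Finite {i : Fin n // G.Adj i.castSucc (Fin.last n)})

instance (G : SimpleGraph (Fin (n + 1))) : Fintype (LastNbr G) :=
  Fintype.ofFinite _

instance (G : SimpleGraph (Fin (n + 1))) : DecidableEq (LastNbr G) :=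
  inferInstanceAs (DecidableEq {i : Fin n // G.Adj i.castSucc (Fin.last n)})

/-- The vector `q̃₁₂` of the free entries of `q₁₂`. -/
def free12 (G : SimpleGraph (Fin (n + 1))) (Q : Matrix (Fin (n + 1)) (Fin (n + 1)) ℝ) :
    EuclideanSpace ℝ (LastNbr G) :=
  WithLp.toLp 2 fun i => block12 Q i.1

/-- `D̃₁₁`, the rows and columns of `D₁₁` belonging to neighbours of the last node. -/
def tilde11 (G : SimpleGraph (Fin (n + 1))) (D : Matrix (Fin (n + 1)) (Fin (n + 1)) ℝ) :
    Matrix (LastNbr G) (LastNbr G) ℝ :=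
  Matrix.of fun i j => block11 D i.1 j.1

/-- `d̃₁₂`, the entries of `d₁₂` belonging to neighbours of the last node. -/
def tilde12 (G : SimpleGraph (Fin (n + 1))) (D : Matrix (Fin (n + 1)) (Fin (n + 1)) ℝ) :
    LastNbr G → ℝ :=
  fun i => block12 D i.1

/-- The rate `(d₂₂ - d̃₁₂ᵀ D̃₁₁⁻¹ d̃₁₂) / 2`. -/
def rate22 (G : SimpleGraph (Fin (n + 1))) (D : Matrix (Fin (n + 1)) (Fin (n + 1)) ℝ) : ℝ :=
  (block22 D - tilde12 G D ⬝ᵥ ((tilde11 G D)⁻¹.mulVec (tilde12 G D))) / 2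

/-- The gamma distribution with shape `(δ + |∂p|) / 2` and rate `rate22`. -/
def law22 (G : SimpleGraph (Fin (n + 1))) (δ : ℝ) (D : Matrix (Fin (n + 1)) (Fin (n + 1)) ℝ) :
    Measure ℝ :=
  gammaMeasure ((δ + ((G.neighborSet (Fin.last n)).ncard : ℝ)) / 2) (rate22 G D)

/-- The Gaussian distribution `N(-t D̃₁₁⁻¹ d̃₁₂, t D̃₁₁⁻¹)`. -/
def law12 (G : SimpleGraph (Fin (n + 1))) (D : Matrix (Fin (n + 1)) (Fin (n + 1)) ℝ) (t : ℝ) :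
    Measure (EuclideanSpace ℝ (LastNbr G)) :=
  multivariateGaussian (WithLp.toLp 2 (-(t • ((tilde11 G D)⁻¹.mulVec (tilde12 G D)))))
    (t • (tilde11 G D)⁻¹)

open Classical in
/-- The vector `q₁₂` with given free entries, its other entries being zero. -/
def extend12 (G : SimpleGraph (Fin (n + 1))) (q : EuclideanSpace ℝ (LastNbr G)) : Fin n → ℝ :=
  fun i => if h : G.Adj i.castSucc (Fin.last n) then q ⟨i, h⟩ else 0

/-- Solve for `Q₁₁ = S + q₁₂ q₁₂ᵀ / t` and put `Q₁₁`, `q₁₂` and `q₂₂ = t` together. -/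
def assemble (G : SimpleGraph (Fin (n + 1))) (t : ℝ) (q : EuclideanSpace ℝ (LastNbr G))
    (S : Matrix (Fin n) (Fin n) ℝ) : Matrix (Fin (n + 1)) (Fin (n + 1)) ℝ :=
  Matrix.of fun i j =>
    Fin.lastCases
      (Fin.lastCases t (extend12 G q) j)
      (fun i' => Fin.lastCases (extend12 G q i')
        (fun j' => S i' j' + extend12 G q i' * extend12 G q j' / t) j) i

/-- The law of the output of one round of the three steps, where `ν` is the law from which the
Schur complement is drawn: draw `t` from `law22` and then `q` from `law12 t`; independently draw
`S` from `ν`; return `assemble t q S`. -/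
def threeSteps (G : SimpleGraph (Fin (n + 1))) (δ : ℝ) (D : Matrix (Fin (n + 1)) (Fin (n + 1)) ℝ)
    (ν : Measure (Matrix (Fin n) (Fin n) ℝ)) : Measure (Matrix (Fin (n + 1)) (Fin (n + 1)) ℝ) :=
  (((law22 G δ D).bind fun t => (law12 G D t).map fun q => (t, q)).prod ν).map
    fun z => assemble G z.1.1 z.1.2 z.2

end LastNode

/-- The law of the output of the recursive procedure on `p = n + 1` nodes: for one node a gamma
variable is drawn; for more nodes the three steps are carried out, with the Schur complement drawn
by the same procedure on the graph without its last node. -/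
def recursiveSampler : (n : ℕ) → SimpleGraph (Fin (n + 1)) → ℝ →
    Matrix (Fin (n + 1)) (Fin (n + 1)) ℝ → Measure (Matrix (Fin (n + 1)) (Fin (n + 1)) ℝ)
  | 0, _, δ, D => (gammaMeasure (δ / 2) (D 0 0 / 2)).map fun t => Matrix.of fun _ _ => t
  | n + 1, G, δ, D => threeSteps G δ D (recursiveSampler n (dropLast G) δ (block11 D))

end GWishart

end

open GWishart

/-! Everything follows from one factorisation. Fix the last column: with $q_{22}=t$ and $\tilde
q_{12}=q$ held constant, replacing $Q_{11}$ by its Schur complement $S$ subtracts the matrix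
$q_{12}q_{12}^T/t$. Because the neighbours of the last node form a clique, this matrix vanishes
outside the diagonal and the edges of the smaller graph, so the change of variables is a translation
of the free parameters and has Jacobian one.

In the variables $(t,q,S)$ the determinant is $t|S|$, positive definiteness means $t>0$ and $S$
positive definite, and the trace splits into $\operatorname{tr}(SD_{11})$ plus a function of $(t,q)$
(`det_assemble`, `posDef_assemble_iff`, `trace_assemble_mul`). Completing the square in $q$ turns
the $(t,q)$ factor into a constant times a gamma density times a Gaussian density (`lastWeight_eq`).
Hence the unnormalised measure of $G$ is a positive finite multiple of the three-step law driven by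
the unnormalised measure of the smaller graph (`unnormalized_eq_smul_threeSteps`).

Induction on the number of nodes gives a finite positive mass. Normalising shows that the three
steps return the G-Wishart law, and the distributional claims are read off from the product form. -/

/-! ### Lebesgue densities of Gaussian measures. -/

section GaussianDensity

variable {ι : Type*} [Fintype ι]

/-- Integrability makes the factors finite, so the product measure is determined by boxes, where
Fubini splits the integral. -/
theorem pi_withDensity_ofReal (f : ι → ℝ → ℝ) (hf : ∀ i, Integrable (f i)) (h0 : ∀ i x, 0 ≤ f i x) :
    Measure.pi (fun i => (volume : Measure ℝ).withDensity fun x => ENNReal.ofReal (f i x)) =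
      (volume : Measure (ι → ℝ)).withDensity fun x => ENNReal.ofReal (∏ i, f i (x i)) := by
  have (i : ι) : IsFiniteMeasure ((volume : Measure ℝ).withDensity fun x => ENNReal.ofReal (f i x)) :=
    isFiniteMeasure_withDensity_ofReal (hf i).2
  refine Measure.pi_eq (μ := fun i => volume.withDensity fun x => ENNReal.ofReal (f i x))
    fun s hs => ?_
  rw [withDensity_apply _ (MeasurableSet.univ_pi hs), volume_pi, Measure.restrict_pi_pi,
    ← ofReal_integral_eq_lintegral_ofReal
      (Integrable.fintype_prod (μ := fun i => volume.restrict (s i)) fun i => (hf i).restrict)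
      (Filter.Eventually.of_forall fun x => Finset.prod_nonneg fun i _ => h0 i _),
    integral_fintype_prod_eq_prod,
    ENNReal.ofReal_prod_of_nonneg fun i _ => integral_nonneg (h0 i)]
  refine Finset.prod_congr rfl fun i _ => ?_
  rw [withDensity_apply _ (hs i), ofReal_integral_eq_lintegral_ofReal (hf i).restrict
    (Filter.Eventually.of_forall (h0 i))]

theorem stdGaussian_eq_withDensity :
    stdGaussian (EuclideanSpace ℝ ι) = volume.withDensity fun x =>
      ENNReal.ofReal ((√(2 * Real.pi))⁻¹ ^ Fintype.card ι * Real.exp (-‖x‖ ^ 2 / 2)) := by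
  have h1 : gaussianReal 0 1 =
      (volume : Measure ℝ).withDensity fun x => ENNReal.ofReal (gaussianPDFReal 0 1 x) := by
    rw [gaussianReal_of_var_ne_zero _ one_ne_zero]; rfl
  rw [← map_pi_eq_stdGaussian, h1, pi_withDensity_ofReal (fun _ => gaussianPDFReal 0 1)
    (fun _ => integrable_gaussianPDFReal 0 1) (fun _ => gaussianPDFReal_nonneg 0 1)]
  refine Measure.ext_of_lintegral _ fun f hf => ?_
  rw [lintegral_map hf (by fun_prop),
    lintegral_withDensity_eq_lintegral_mul _ (by fun_prop) (by fun_prop),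
    lintegral_withDensity_eq_lintegral_mul _ (by fun_prop) (by fun_prop),
    ← (PiLp.volume_preserving_toLp ι).lintegral_comp (by fun_prop)]
  refine lintegral_congr fun x => ?_
  simp only [Pi.mul_apply, gaussianPDFReal, Finset.prod_mul_distrib, ← Real.exp_sum]
  simp [EuclideanSpace.real_norm_sq_eq, neg_div, Finset.sum_div]

variable [DecidableEq ι]

-- The measure is the image of the standard Gaussian under $x\mapsto\mu+Ax$ with $A$ the symmetric
-- root of $S$. The Jacobian is $|A|=|S|^{1/2}$, and $AS^{-1}A=1$ turns the quadratic form into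
-- $\|x\|^2$.
open scoped MatrixOrder in
theorem multivariateGaussian_eq_withDensity (μ : EuclideanSpace ℝ ι) {S : Matrix ι ι ℝ}
    (hS : S.PosDef) :
    multivariateGaussian μ S = volume.withDensity fun x =>
      ENNReal.ofReal ((√(2 * Real.pi))⁻¹ ^ Fintype.card ι * (√S.det)⁻¹ *
        Real.exp (-((x - μ).ofLp ⬝ᵥ S⁻¹.mulVec (x - μ).ofLp) / 2)) := by
  set A := CFC.sqrt S with hA
  have hAA : A * A = S := CFC.sqrt_mul_sqrt_self S hS.posSemidef.nonneg
  have hdet : A.det = √S.det := by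
    rw [hA, hS.posSemidef.det_sqrt, RCLike.sqrt_of_nonneg hS.det_pos.le]; simp
  have hdet0 : 0 < A.det := by rw [hdet]; exact Real.sqrt_pos.2 hS.det_pos
  have hAT : A.transpose = A := by
    simpa [Matrix.IsHermitian] using (Matrix.nonneg_iff_posSemidef.1 (CFC.sqrt_nonneg S)).isHermitian
  have hunit : IsUnit A.det := hdet0.ne'.isUnit
  have hASA : A * S⁻¹ * A = 1 := by
    rw [← hAA, Matrix.mul_inv_rev, ← mul_assoc, A.mul_nonsing_inv hunit, one_mul,
      A.nonsing_inv_mul hunit]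
  have hcont (v : EuclideanSpace ℝ ι) : Continuous fun x : EuclideanSpace ℝ ι =>
      (x - v).ofLp ⬝ᵥ S⁻¹.mulVec (x - v).ofLp := by fun_prop
  have hm (v : EuclideanSpace ℝ ι) := (hcont v).measurable
  refine Measure.ext_of_lintegral _ fun f hf => ?_
  have hLdet : LinearMap.det (Matrix.toEuclideanLin A) = A.det := by
    rw [Matrix.toEuclideanLin_eq_toLin_orthonormal, LinearMap.det_toLin]
  have hvol := Measure.map_linearMap_addHaar_eq_smul_addHaar (volume : Measure (EuclideanSpace ℝ ι))
    (f := Matrix.toEuclideanLin A) (by rw [hLdet]; exact hdet0.ne')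
  rw [multivariateGaussian, lintegral_map hf (by fun_prop), stdGaussian_eq_withDensity,
    lintegral_withDensity_eq_lintegral_mul _ (by fun_prop) (by fun_prop),
    lintegral_withDensity_eq_lintegral_mul _ (by fun_prop) (by fun_prop)]
  have hL : Measurable (Matrix.toEuclideanLin A) :=
    (Matrix.toEuclideanLin A).continuous_of_finiteDimensional.measurable
  set g : EuclideanSpace ℝ ι → ENNReal := fun x =>
      ENNReal.ofReal ((√(2 * Real.pi))⁻¹ ^ Fintype.card ι * (√S.det)⁻¹ *
        Real.exp (-((x - μ).ofLp ⬝ᵥ S⁻¹.mulVec (x - μ).ofLp) / 2)) with hg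
  have hgm : Measurable g := by fun_prop
  conv_rhs => rw [← lintegral_add_left_eq_self _ μ]
  -- Lebesgue measure is $|A|$ times its own image under $A$; this brings both sides to integrals
  -- over the same variable.
  have hvol' : (volume : Measure (EuclideanSpace ℝ ι)) =
      ENNReal.ofReal A.det • Measure.map (Matrix.toEuclideanLin A) volume := by
    rw [hvol, smul_smul, hLdet, ← ENNReal.ofReal_mul hdet0.le, abs_of_pos (inv_pos.2 hdet0),
      mul_inv_cancel₀ hdet0.ne']
    simp
  conv_rhs => rw [hvol', lintegral_smul_measure]
  rw [lintegral_map (by fun_prop) hL, smul_eq_mul, ← lintegral_const_mul _ (by fun_prop)]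
  refine lintegral_congr fun x => ?_
  have hq : (Matrix.toEuclideanLin A x).ofLp ⬝ᵥ S⁻¹.mulVec (Matrix.toEuclideanLin A x).ofLp =
      ‖x‖ ^ 2 := by
    have : (Matrix.toEuclideanLin A x).ofLp = A.mulVec x.ofLp := rfl
    have hx : Matrix.vecMul x.ofLp A = A.mulVec x.ofLp := by
      rw [← Matrix.mulVec_transpose, hAT]
    rw [this, ← hx, ← Matrix.dotProduct_mulVec, hx, Matrix.mulVec_mulVec, Matrix.mulVec_mulVec,
      hASA, Matrix.one_mulVec, EuclideanSpace.real_norm_sq_eq]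
    simp [dotProduct, sq]
  simp only [Pi.mul_apply, hg, add_sub_cancel_left, hq]
  rw [← mul_assoc, ← ENNReal.ofReal_mul hdet0.le, hdet]
  have : √S.det ≠ 0 := hdet ▸ hdet0.ne'
  congr 2
  field_simp

end GaussianDensity

namespace GWishart

/-! ### Determinant, positivity and trace in Schur coordinates. -/

section Algebra

variable {n : ℕ} (G : SimpleGraph (Fin (n + 1)))

@[simp] theorem assemble_last_last (t : ℝ) (q : EuclideanSpace ℝ (LastNbr G))
    (S : Matrix (Fin n) (Fin n) ℝ) : assemble G t q S (Fin.last n) (Fin.last n) = t := by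
  simp [assemble]

@[simp] theorem assemble_castSucc_last (t : ℝ) (q : EuclideanSpace ℝ (LastNbr G))
    (S : Matrix (Fin n) (Fin n) ℝ) (i : Fin n) :
    assemble G t q S i.castSucc (Fin.last n) = extend12 G q i := by
  simp [assemble]

@[simp] theorem assemble_last_castSucc (t : ℝ) (q : EuclideanSpace ℝ (LastNbr G))
    (S : Matrix (Fin n) (Fin n) ℝ) (i : Fin n) :
    assemble G t q S (Fin.last n) i.castSucc = extend12 G q i := by
  simp [assemble]

@[simp] theorem assemble_castSucc_castSucc (t : ℝ) (q : EuclideanSpace ℝ (LastNbr G))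
    (S : Matrix (Fin n) (Fin n) ℝ) (i j : Fin n) :
    assemble G t q S i.castSucc j.castSucc = S i j + extend12 G q i * extend12 G q j / t := by
  simp [assemble]

@[simp] theorem block22_assemble (t : ℝ) (q : EuclideanSpace ℝ (LastNbr G))
    (S : Matrix (Fin n) (Fin n) ℝ) : block22 (assemble G t q S) = t := by
  simp [block22]

@[simp] theorem block12_assemble (t : ℝ) (q : EuclideanSpace ℝ (LastNbr G))
    (S : Matrix (Fin n) (Fin n) ℝ) : block12 (assemble G t q S) = extend12 G q := by
  ext i; simp [block12]

-- At $t=0$ both corrections vanish, since division by zero gives zero; no condition on $t$ is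
-- needed when laws are pushed forward.
@[simp] theorem schur11_assemble (t : ℝ) (q : EuclideanSpace ℝ (LastNbr G))
    (S : Matrix (Fin n) (Fin n) ℝ) : schur11 (assemble G t q S) = S := by
  ext i j
  simp only [schur11, block11, block22_assemble, block12_assemble, Matrix.sub_apply,
    Matrix.submatrix_apply, assemble_castSucc_castSucc, Matrix.smul_apply, Matrix.vecMulVec_apply,
    smul_eq_mul]
  ring

theorem extend12_lastNbr (q : EuclideanSpace ℝ (LastNbr G)) (i : LastNbr G) :
    extend12 G q i.1 = q i := by
  have := i.2
  simp only [extend12, dif_pos this]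
  rfl

@[simp] theorem free12_assemble (t : ℝ) (q : EuclideanSpace ℝ (LastNbr G))
    (S : Matrix (Fin n) (Fin n) ℝ) : free12 G (assemble G t q S) = q := by
  ext i
  simp [free12, extend12_lastNbr]

theorem sum_extend12_mul (q : EuclideanSpace ℝ (LastNbr G)) (f : Fin n → ℝ) :
    ∑ i, extend12 G q i * f i = ∑ i : LastNbr G, q i * f i.1 := by
  classical
  let e : LastNbr G ↪ Fin n := ⟨Subtype.val, Subtype.val_injective⟩
  have h : ∀ i ∈ Finset.univ, i ∉ Finset.univ.map e → extend12 G q i * f i = 0 := by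
    intro i _ hi
    have : ¬ G.Adj i.castSucc (Fin.last n) := fun h =>
      hi (Finset.mem_map.2 ⟨(⟨i, h⟩ : {i : Fin n // G.Adj i.castSucc (Fin.last n)}),
        Finset.mem_univ _, rfl⟩)
    simp [extend12, this]
  rw [← Finset.sum_subset (Finset.subset_univ _) h, Finset.sum_map]
  exact Finset.sum_congr rfl fun i _ => by rw [← extend12_lastNbr G q i]; rfl

theorem submatrix_assemble (t : ℝ) (q : EuclideanSpace ℝ (LastNbr G))
    (S : Matrix (Fin n) (Fin n) ℝ) :
    (assemble G t q S).submatrix (finSumFinEquiv : Fin n ⊕ Fin 1 ≃ _) finSumFinEquiv =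
      Matrix.fromBlocks (S + t⁻¹ • Matrix.vecMulVec (extend12 G q) (extend12 G q))
        (Matrix.of fun i _ => extend12 G q i) (Matrix.of fun i _ => extend12 G q i).conjTranspose
        (Matrix.of fun _ _ => t) := by
  have h1 (i : Fin n) : Fin.castAdd 1 i = i.castSucc := rfl
  have h2 (i : Fin 1) : Fin.natAdd n i = Fin.last n := by
    ext; simp
  ext (i | i) (j | j)
  · simp [h1, Matrix.vecMulVec_apply]; ring
  · simp [h1, h2]
  · simp [h1, h2]
  · simp [h2]

theorem schur_fromBlocks_cancel {t : ℝ} (S : Matrix (Fin n) (Fin n) ℝ) (v : Fin n → ℝ) :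
    S + t⁻¹ • Matrix.vecMulVec v v - (Matrix.of fun i (_ : Fin 1) => v i) *
      (Matrix.of fun _ _ : Fin 1 => t)⁻¹ * (Matrix.of fun i (_ : Fin 1) => v i).conjTranspose = S := by
  ext i j
  simp [Matrix.inv_subsingleton, Matrix.mul_apply, Matrix.vecMulVec_apply]
  ring

theorem det_assemble {t : ℝ} (ht : t ≠ 0) (q : EuclideanSpace ℝ (LastNbr G))
    (S : Matrix (Fin n) (Fin n) ℝ) : (assemble G t q S).det = t * S.det := by
  have hu : IsUnit (Matrix.of fun _ _ : Fin 1 => t) := by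
    rw [Matrix.isUnit_iff_isUnit_det]; simpa using ht
  let := hu.invertible
  rw [← Matrix.det_submatrix_equiv_self (finSumFinEquiv : Fin n ⊕ Fin 1 ≃ _), submatrix_assemble,
    Matrix.det_fromBlocks₂₂, Matrix.invOf_eq_nonsing_inv, schur_fromBlocks_cancel]
  simp

-- For $t>0$ the Schur criterion transfers semidefiniteness; a semidefinite matrix is definite
-- exactly when its determinant is nonzero, and the determinant is $t|S|$.
open scoped MatrixOrder in
theorem posDef_assemble_iff (t : ℝ) (q : EuclideanSpace ℝ (LastNbr G))
    (S : Matrix (Fin n) (Fin n) ℝ) : (assemble G t q S).PosDef ↔ 0 < t ∧ S.PosDef := by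
  by_cases ht : 0 < t
  swap
  · exact ⟨fun h => absurd (by simpa using h.diag_pos (i := Fin.last n)) ht, fun h => absurd h.1 ht⟩
  have hD : (Matrix.of fun _ _ : Fin 1 => t).PosDef := by
    have : (Matrix.of fun _ _ : Fin 1 => t) = Matrix.diagonal fun _ => t := by
      ext i j; simp [Subsingleton.elim i j]
    rw [this]; exact Matrix.PosDef.diagonal fun _ => ht
  let := hD.isUnit.invertible
  have hsd : (assemble G t q S).PosSemidef ↔ S.PosSemidef := by
    rw [← Matrix.posSemidef_submatrix_equiv (finSumFinEquiv : Fin n ⊕ Fin 1 ≃ _), submatrix_assemble,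
      hD.fromBlocks₂₂, schur_fromBlocks_cancel]
  refine ⟨fun h => ⟨ht, (hsd.1 h.posSemidef).posDef_iff_det_ne_zero.2 fun h0 => h.det_pos.ne' ?_⟩,
    fun h => (hsd.2 h.2.posSemidef).posDef_iff_det_ne_zero.2 ?_⟩
  · rw [det_assemble G ht.ne', h0, mul_zero]
  · rw [det_assemble G ht.ne']
    exact mul_ne_zero ht.ne' h.2.det_pos.ne'

/-- This additivity is what makes the exponential factor. Sums over all lower nodes reduce to
$\partial p$ because the extended vector is zero elsewhere. -/
theorem trace_assemble_mul (t : ℝ) (q : EuclideanSpace ℝ (LastNbr G))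
    (S : Matrix (Fin n) (Fin n) ℝ) {D : Matrix (Fin (n + 1)) (Fin (n + 1)) ℝ}
    (hD : D.IsHermitian) :
    (assemble G t q S * D).trace = (S * block11 D).trace +
      (q.ofLp ⬝ᵥ (tilde11 G D).mulVec q.ofLp / t + 2 * (q.ofLp ⬝ᵥ tilde12 G D) + t * block22 D) := by
  have hsym (i j) : D i j = D j i := by simpa using hD.apply j i
  have h1 : ∑ i, extend12 G q i * D i.castSucc (Fin.last n) = q.ofLp ⬝ᵥ tilde12 G D :=
    sum_extend12_mul G q _
  have h1' : ∑ i, extend12 G q i * D (Fin.last n) i.castSucc = q.ofLp ⬝ᵥ tilde12 G D := by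
    rw [← h1]; exact Finset.sum_congr rfl fun i _ => by rw [hsym]
  have h2 : ∑ i, extend12 G q i * ∑ j, extend12 G q j * D j.castSucc i.castSucc =
      q.ofLp ⬝ᵥ (tilde11 G D).mulVec q.ofLp := by
    rw [sum_extend12_mul G q]
    refine Finset.sum_congr rfl fun i _ => ?_
    rw [sum_extend12_mul G q]
    congr 1
    refine Finset.sum_congr rfl fun j _ => ?_
    rw [mul_comm, hsym]; rfl
  simp only [Matrix.trace, Matrix.diag_apply, Matrix.mul_apply, Fin.sum_univ_castSucc,
    assemble_last_last, assemble_castSucc_last, assemble_last_castSucc, assemble_castSucc_castSucc,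
    add_mul, Finset.sum_add_distrib, h1, h1']
  have h3 : ∑ i, ∑ j, extend12 G q i * extend12 G q j / t * D j.castSucc i.castSucc =
      q.ofLp ⬝ᵥ (tilde11 G D).mulVec q.ofLp / t := by
    rw [← h2, Finset.sum_div]
    refine Finset.sum_congr rfl fun i _ => ?_
    rw [Finset.mul_sum, Finset.sum_div]
    exact Finset.sum_congr rfl fun j _ => by ring
  rw [h3]
  simp only [block11, block22, Matrix.submatrix_apply]
  ring

end Algebra

/-! ### The gamma rate and the completed square. -/

section Rate

variable {n : ℕ} (G : SimpleGraph (Fin (n + 1))) {D : Matrix (Fin (n + 1)) (Fin (n + 1)) ℝ}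

theorem posDef_tilde11 (hD : D.PosDef) : (tilde11 G D).PosDef :=
  hD.submatrix (e := fun i : LastNbr G => i.1.castSucc)
    ((Fin.castSucc_injective n).comp Subtype.val_injective)

theorem posDef_block11 (hD : D.PosDef) : (block11 D).PosDef :=
  hD.submatrix (Fin.castSucc_injective n)

theorem tilde11_mulVec_inv (hD : D.PosDef) (v : LastNbr G → ℝ) :
    (tilde11 G D).mulVec ((tilde11 G D)⁻¹.mulVec v) = v := by
  rw [Matrix.mulVec_mulVec, Matrix.mul_nonsing_inv _ (posDef_tilde11 G hD).det_pos.ne'.isUnit,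
    Matrix.one_mulVec]

theorem dotProduct_tilde11_mulVec_comm (hD : D.PosDef) (u v : LastNbr G → ℝ) :
    u ⬝ᵥ (tilde11 G D).mulVec v = v ⬝ᵥ (tilde11 G D).mulVec u := by
  have h : (tilde11 G D).transpose = tilde11 G D := by
    simpa [Matrix.IsHermitian] using (posDef_tilde11 G hD).isHermitian
  rw [Matrix.dotProduct_mulVec, ← Matrix.mulVec_transpose, h, dotProduct_comm]

/-- Twice the rate is $x^TDx$, where $x$ has last entry $1$, entries $-\tilde D_{11}^{-1}\tilde
d_{12}$ on $\partial p$ and zeros elsewhere. Since $xx^T$ is the assembled matrix with $t=1$ and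
$S=0$, the trace formula evaluates this form. -/
theorem rate22_pos (hD : D.PosDef) : 0 < rate22 G D := by
  set m := (tilde11 G D)⁻¹.mulVec (tilde12 G D) with hm
  set q : EuclideanSpace ℝ (LastNbr G) := WithLp.toLp 2 (-m) with hq
  set x : Fin (n + 1) → ℝ := Fin.snoc (extend12 G q) 1 with hx
  have h1 : assemble G 1 q 0 = Matrix.vecMulVec x x := by
    ext i j
    refine Fin.lastCases ?_ (fun i => ?_) i <;> refine Fin.lastCases ?_ (fun j => ?_) j <;>
      simp [hx, Matrix.vecMulVec_apply]
  have h2 := trace_assemble_mul G 1 q 0 hD.isHermitian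
  have hx0 : x ≠ 0 := fun h => by simpa [hx] using congrFun h (Fin.last n)
  have h3 : 0 < x ⬝ᵥ D.mulVec x := by simpa using hD.dotProduct_mulVec_pos hx0
  have h4 : (Matrix.vecMulVec x x * D).trace = x ⬝ᵥ D.mulVec x := by
    rw [Matrix.trace_mul_comm, Matrix.mul_vecMulVec, Matrix.trace_vecMulVec, dotProduct_comm]
  rw [h1, h4] at h2
  rw [h2] at h3
  simp only [hq, Matrix.mulVec_neg, hm, tilde11_mulVec_inv G hD, zero_mul, Matrix.trace_zero,
    neg_dotProduct, dotProduct_neg] at h3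
  rw [rate22, dotProduct_comm]
  linarith

/-- The square displays the Gaussian mean and covariance; the remainder, linear in $t$, is the gamma
exponent. -/
theorem complete_square (hD : D.PosDef) {t : ℝ} (ht : t ≠ 0) (q : LastNbr G → ℝ) :
    q ⬝ᵥ (tilde11 G D).mulVec q / t + 2 * (q ⬝ᵥ tilde12 G D) + t * block22 D =
      (q + t • (tilde11 G D)⁻¹.mulVec (tilde12 G D)) ⬝ᵥ (t • (tilde11 G D)⁻¹)⁻¹.mulVec
        (q + t • (tilde11 G D)⁻¹.mulVec (tilde12 G D)) + 2 * (rate22 G D * t) := by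
  have hu : IsUnit (tilde11 G D).det := (posDef_tilde11 G hD).det_pos.ne'.isUnit
  have hinv : (t • (tilde11 G D)⁻¹)⁻¹ = t⁻¹ • tilde11 G D := by
    refine Matrix.inv_eq_right_inv ?_
    rw [Matrix.smul_mul, Matrix.mul_smul, smul_smul, mul_inv_cancel₀ ht, one_smul,
      Matrix.nonsing_inv_mul _ hu]
  rw [hinv, rate22]
  set m := (tilde11 G D)⁻¹.mulVec (tilde12 G D) with hm
  have h1 : (tilde11 G D).mulVec m = tilde12 G D := tilde11_mulVec_inv G hD _
  simp only [Matrix.smul_mulVec, Matrix.mulVec_add, Matrix.mulVec_smul, add_dotProduct,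
    dotProduct_add, smul_dotProduct, dotProduct_smul, smul_eq_mul, h1]
  rw [dotProduct_tilde11_mulVec_comm G hD m q, h1, dotProduct_comm (tilde12 G D) m]
  field_simp
  ring

theorem ncard_neighborSet_last :
    (G.neighborSet (Fin.last n)).ncard = Fintype.card (LastNbr G) := by
  have : G.neighborSet (Fin.last n) =
      Set.range (fun i : LastNbr G => i.1.castSucc) := by
    ext j
    simp only [SimpleGraph.mem_neighborSet, Set.mem_range]
    refine ⟨fun h => ?_, ?_⟩
    · obtain ⟨i, rfl⟩ := Fin.exists_castSucc_eq.2 h.ne'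
      exact ⟨(⟨i, h.symm⟩ : {i : Fin n // G.Adj i.castSucc (Fin.last n)}), rfl⟩
    · rintro ⟨i, rfl⟩
      exact i.2.symm
  have hinj : Function.Injective fun i : LastNbr G => i.1.castSucc :=
    (Fin.castSucc_injective n).comp Subtype.val_injective
  rw [this, ← Nat.card_coe_set_eq, Nat.card_range_of_injective hinj, Nat.card_eq_fintype_card]

end Rate

/-! ### Lebesgue measure on the free parameters, split at the last node. -/

section Coordinates

variable {n : ℕ} (G : SimpleGraph (Fin (n + 1)))

/-- Sorts the free parameters of `G` into the last diagonal entry, the edges at the last node, and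
the free parameters of the graph without its last node. -/
def splitParam : Unit ⊕ (LastNbr G ⊕ FreeParam (dropLast G)) → FreeParam G
  | .inl _ => Sum.inl (Fin.last n)
  | .inr (.inl i) => Sum.inr ⟨s(i.1.castSucc, Fin.last n), i.2⟩
  | .inr (.inr (.inl i)) => Sum.inl i.castSucc
  | .inr (.inr (.inr e)) => Sum.inr ((SimpleGraph.Hom.comap Fin.castSucc G).mapEdgeSet e)

theorem splitParam_bijective : Function.Bijective (splitParam G) := by
  constructor
  · rintro (_ | i | i | ⟨e, he⟩) (_ | j | j | ⟨f, hf⟩) h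
    · rfl
    · cases h
    · exact absurd (Sum.inl.inj h) (Fin.castSucc_ne_last j).symm
    · cases h
    · cases h
    · have h' := congrArg Subtype.val (Sum.inr.inj h)
      have h2 : i.1.castSucc = j.1.castSucc := by simpa using h'
      rw [show i = j from Subtype.ext (Fin.castSucc_injective n h2)]
    · cases h
    · have h' : s(i.1.castSucc, Fin.last n) = f.map Fin.castSucc :=
        congrArg Subtype.val (Sum.inr.inj h)
      have : Fin.last n ∈ f.map Fin.castSucc := h' ▸ Sym2.mem_mk_right _ _
      obtain ⟨a, -, ha⟩ := Sym2.mem_map.1 this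
      exact absurd ha (Fin.castSucc_ne_last a)
    · exact absurd (Sum.inl.inj h) (Fin.castSucc_ne_last i)
    · cases h
    · rw [Fin.castSucc_injective n (Sum.inl.inj h)]
    · cases h
    · cases h
    · have h' : e.map Fin.castSucc = s(j.1.castSucc, Fin.last n) :=
        congrArg Subtype.val (Sum.inr.inj h)
      have : Fin.last n ∈ e.map Fin.castSucc := h' ▸ Sym2.mem_mk_right _ _
      obtain ⟨a, -, ha⟩ := Sym2.mem_map.1 this
      exact absurd ha (Fin.castSucc_ne_last a)
    · cases h
    · have h' : e.map Fin.castSucc = f.map Fin.castSucc := congrArg Subtype.val (Sum.inr.inj h)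
      have := Sym2.map.injective (Fin.castSucc_injective n) h'
      subst this
      rfl
  · rintro (i | ⟨e, he⟩)
    · refine Fin.lastCases ⟨.inl (), rfl⟩ (fun i => ⟨.inr (.inr (.inl i)), rfl⟩) i
    · induction e with | _ i j
      have hadj : G.Adj i j := he
      induction i using Fin.lastCases with
      | last =>
        induction j using Fin.lastCases with
        | last => exact absurd hadj (G.irrefl)
        | cast j => exact ⟨.inr (.inl ⟨j, hadj.symm⟩), by
            simp only [splitParam]; congr 2; exact Sym2.eq_swap⟩
      | cast i =>
        induction j using Fin.lastCases with
        | last => exact ⟨.inr (.inl ⟨i, hadj⟩), rfl⟩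
        | cast j => exact ⟨.inr (.inr (.inr ⟨s(i, j), hadj⟩)), rfl⟩

/-- The bijection underlying `splitParam`. -/
noncomputable def splitEquiv : Unit ⊕ (LastNbr G ⊕ FreeParam (dropLast G)) ≃ FreeParam G :=
  Equiv.ofBijective _ (splitParam_bijective G)

/-- The free parameters of `G` with prescribed last diagonal entry, last column and remaining
entries. -/
noncomputable def joinParam (t : ℝ) (q : EuclideanSpace ℝ (LastNbr G)) (s : FreeParam (dropLast G) → ℝ) :
    FreeParam G → ℝ :=
  fun x => Sum.elim (fun _ => t) (Sum.elim q s) ((splitEquiv G).symm x)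

theorem joinParam_splitParam (t : ℝ) (q : EuclideanSpace ℝ (LastNbr G))
    (s : FreeParam (dropLast G) → ℝ) (x) :
    joinParam G t q s (splitParam G x) = Sum.elim (fun _ => t) (Sum.elim q s) x := by
  unfold joinParam
  congr 1
  exact (splitEquiv G).symm_apply_apply x

theorem measurePreserving_joinParam :
    MeasurePreserving fun z : ℝ × (EuclideanSpace ℝ (LastNbr G) × (FreeParam (dropLast G) → ℝ)) =>
      joinParam G z.1 z.2.1 z.2.2 := by
  have h1 := volume_preserving_arrowCongr' (splitEquiv G) (MeasurableEquiv.refl ℝ)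
    (MeasurePreserving.id _)
  have h2 := volume_measurePreserving_sumPiEquivProdPi_symm
    (fun _ : Unit ⊕ (LastNbr G ⊕ FreeParam (dropLast G)) => ℝ)
  have h3 := volume_measurePreserving_sumPiEquivProdPi_symm
    (fun _ : LastNbr G ⊕ FreeParam (dropLast G) => ℝ)
  have h4 := (volume_preserving_funUnique Unit ℝ).symm
  have h5 := PiLp.volume_preserving_ofLp (LastNbr G)
  have h := h1.comp (h2.comp (h4.prod (h3.comp (h5.prod
    (MeasurePreserving.id (volume : Measure (FreeParam (dropLast G) → ℝ)))))))
  exact h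

theorem lintegral_freeParam {F : (FreeParam G → ℝ) → ENNReal} (hF : Measurable F) :
    ∫⁻ x, F x = ∫⁻ t, ∫⁻ q, ∫⁻ s, F (joinParam G t q s) := by
  have h := measurePreserving_joinParam G
  have hm : Measurable fun z : ℝ × (EuclideanSpace ℝ (LastNbr G) × (FreeParam (dropLast G) → ℝ)) =>
      F (joinParam G z.1 z.2.1 z.2.2) := hF.comp h.measurable
  rw [← h.lintegral_comp hF, Measure.volume_eq_prod, lintegral_prod _ hm.aemeasurable]
  refine lintegral_congr fun t => ?_
  exact lintegral_prod _ (hm.comp measurable_prodMk_left).aemeasurable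

/-- The change of the free parameters of the upper left block caused by adding
`q₁₂ q₁₂ᵀ / t` to it. -/
noncomputable def outerParam (t : ℝ) (q : EuclideanSpace ℝ (LastNbr G)) :
    FreeParam (dropLast G) → ℝ :=
  Sum.elim (fun i => extend12 G q i * extend12 G q i / t)
    (fun e => Sym2.lift ⟨fun i j => extend12 G q i * extend12 G q j / t,
      fun i j => by simp only [mul_comm]⟩ e.1)

/-- Here perfectness enters: a nonzero product needs two neighbours of the last node, and these are
adjacent. The rank-one update therefore creates no fill-in. -/
theorem extend12_mul_extend12_eq_zero (hG : IsPerfectlyOrdered G)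
    (q : EuclideanSpace ℝ (LastNbr G)) {i j : Fin n} (hij : i ≠ j)
    (h : ¬ (dropLast G).Adj i j) : extend12 G q i * extend12 G q j = 0 := by
  by_cases hi : G.Adj i.castSucc (Fin.last n)
  swap
  · simp [extend12, hi]
  by_cases hj : G.Adj j.castSucc (Fin.last n)
  swap
  · simp [extend12, hj]
  exact absurd (hG (Fin.last n) ⟨hi.symm, Fin.castSucc_lt_last i⟩ ⟨hj.symm, Fin.castSucc_lt_last j⟩
    fun h => hij (Fin.castSucc_injective n h)) h

theorem toMatrix_apply_self {V : Type*} [DecidableEq V] (G : SimpleGraph V) (x : FreeParam G → ℝ)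
    (i : V) : toMatrix G x i i = x (Sum.inl i) := by
  simp [toMatrix]

theorem toMatrix_apply_adj {V : Type*} [DecidableEq V] (G : SimpleGraph V) (x : FreeParam G → ℝ)
    {i j : V} (h : G.Adj i j) : toMatrix G x i j = x (Sum.inr ⟨s(i, j), h⟩) := by
  simp [toMatrix, h, h.ne]

theorem toMatrix_apply_of_not_adj {V : Type*} [DecidableEq V] (G : SimpleGraph V)
    (x : FreeParam G → ℝ) {i j : V} (hij : i ≠ j) (h : ¬ G.Adj i j) : toMatrix G x i j = 0 := by
  simp [toMatrix, h, hij]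

theorem toMatrix_comm {V : Type*} [DecidableEq V] (G : SimpleGraph V)
    (x : FreeParam G → ℝ) (i j : V) : toMatrix G x i j = toMatrix G x j i := by
  by_cases hij : i = j
  · rw [hij]
  by_cases h : G.Adj i j
  · rw [toMatrix_apply_adj G x h, toMatrix_apply_adj G x h.symm]
    congr 2
    exact Subtype.ext Sym2.eq_swap
  · rw [toMatrix_apply_of_not_adj G x hij h,
      toMatrix_apply_of_not_adj G x (Ne.symm hij) fun h' => h h'.symm]

/-- For fixed $(t,q)$ the passage from $S$ to $Q_{11}$ is a translation in the free parameters. -/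
theorem toMatrix_joinParam (hG : IsPerfectlyOrdered G) (t : ℝ) (q : EuclideanSpace ℝ (LastNbr G))
    (s : FreeParam (dropLast G) → ℝ) :
    toMatrix G (joinParam G t q (s + outerParam G t q)) =
      assemble G t q (toMatrix (dropLast G) s) := by
  set s' := s + outerParam G t q with hs'
  have hcol (i : Fin n) : toMatrix G (joinParam G t q s') i.castSucc (Fin.last n) =
      extend12 G q i := by
    by_cases h : G.Adj i.castSucc (Fin.last n)
    · rw [toMatrix_apply_adj G _ h]
      refine (joinParam_splitParam G t q s' (.inr (.inl ⟨i, h⟩))).trans ?_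
      exact (extend12_lastNbr G q ⟨i, h⟩).symm
    · rw [toMatrix_apply_of_not_adj G _ (Fin.castSucc_ne_last i) h]
      simp [extend12, h]
  ext i j
  induction i using Fin.lastCases with
  | last =>
    induction j using Fin.lastCases with
    | last =>
      rw [toMatrix_apply_self, assemble_last_last]
      exact joinParam_splitParam G t q s' (.inl ())
    | cast j => rw [toMatrix_comm, hcol, assemble_last_castSucc]
  | cast i =>
    induction j using Fin.lastCases with
    | last => rw [hcol, assemble_castSucc_last]
    | cast j =>
      rw [assemble_castSucc_castSucc]
      by_cases hij : i = j
      · subst hij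
        rw [toMatrix_apply_self, toMatrix_apply_self]
        exact joinParam_splitParam G t q s' (.inr (.inr (.inl i)))
      by_cases h : (dropLast G).Adj i j
      · have h' : G.Adj i.castSucc j.castSucc := h
        rw [toMatrix_apply_adj G _ h', toMatrix_apply_adj _ _ h]
        exact joinParam_splitParam G t q s' (.inr (.inr (.inr ⟨s(i, j), h⟩)))
      · rw [toMatrix_apply_of_not_adj G _ (fun h => hij (Fin.castSucc_injective n h)) h,
          toMatrix_apply_of_not_adj _ _ hij h, extend12_mul_extend12_eq_zero G hG q hij h]
        simp

end Coordinates

/-! ### Measurability of the cone and the density. -/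

section Measurability

instance {m n : Type*} [Countable m] [Countable n] : BorelSpace (Matrix m n ℝ) :=
  inferInstanceAs (BorelSpace (m → n → ℝ))

variable {V : Type*} [Fintype V]

theorem isClosed_posSemidef : IsClosed {Q : Matrix V V ℝ | Q.PosSemidef} := by
  simp only [Matrix.posSemidef_iff_dotProduct_mulVec, Set.ofPred_and, Set.ofPred_forall]
  refine IsClosed.inter ?_ (isClosed_iInter fun x => isClosed_le continuous_const (by fun_prop))
  exact isClosed_eq (by fun_prop) continuous_id

variable [DecidableEq V] (G : SimpleGraph V)

theorem measurableSet_precisionCone : MeasurableSet (precisionCone G) := by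
  have h : precisionCone G = ({Q | Q.PosSemidef} ∩ {Q | Q.det ≠ 0}) ∩
      {Q | ∀ i j, i ≠ j → ¬ G.Adj i j → Q i j = 0} := by
    ext Q
    refine and_congr_left fun _ => ⟨fun h => ⟨h.posSemidef, h.det_pos.ne'⟩, fun h => ?_⟩
    exact h.1.posDef_iff_det_ne_zero.2 h.2
  rw [h]
  refine (isClosed_posSemidef.measurableSet.inter ?_).inter (IsClosed.measurableSet ?_)
  · exact (isOpen_ne_fun (by fun_prop) continuous_const).measurableSet
  · simp only [Set.ofPred_forall]
    exact isClosed_iInter fun i => isClosed_iInter fun j => isClosed_iInter fun _ =>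
      isClosed_iInter fun _ => isClosed_eq (by fun_prop) continuous_const

theorem measurable_density (δ : ℝ) (D : Matrix V V ℝ) : Measurable (density G δ D) := by
  have h1 : Measurable fun Q : Matrix V V ℝ => Q.det := by
    have : Continuous fun Q : Matrix V V ℝ => Q.det := by fun_prop
    exact this.measurable
  have h2 : Measurable fun Q : Matrix V V ℝ => (Q * D).trace := by
    have : Continuous fun Q : Matrix V V ℝ => (Q * D).trace := by fun_prop
    exact this.measurable
  exact Measurable.indicator (by fun_prop) (measurableSet_precisionCone G)

omit [Fintype V] in
theorem measurable_toMatrix : Measurable (toMatrix G) := by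
  refine measurable_pi_iff.2 fun i => measurable_pi_iff.2 fun j => ?_
  simp only [toMatrix, Matrix.of_apply]
  split_ifs
  · exact measurable_pi_apply _
  · exact measurable_pi_apply _
  · exact measurable_const

omit [Fintype V] in
theorem toMatrix_mem_precisionCone {x : FreeParam G → ℝ} :
    toMatrix G x ∈ precisionCone G ↔ (toMatrix G x).PosDef :=
  ⟨fun h => h.1, fun h => ⟨h, fun _ _ hij => toMatrix_apply_of_not_adj G x hij⟩⟩

/-- Enough for Tonelli while finiteness of the mass is still unproved. -/
instance (δ : ℝ) (D : Matrix V V ℝ) : SFinite (unnormalized G δ D) := by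
  unfold unnormalized; infer_instance

theorem lintegral_unnormalized (δ : ℝ) (D : Matrix V V ℝ) {f : Matrix V V ℝ → ENNReal}
    (hf : Measurable f) :
    ∫⁻ Q, f Q ∂unnormalized G δ D = ∫⁻ x, density G δ D (toMatrix G x) * f (toMatrix G x) := by
  have hm := measurable_toMatrix G
  rw [unnormalized, lintegral_map hf hm]
  exact lintegral_withDensity_eq_lintegral_mul _ ((measurable_density G δ D).comp hm) (hf.comp hm)

end Measurability

/-! ### The three steps as a composition product. -/

section Kernels

variable {n : ℕ} (G : SimpleGraph (Fin (n + 1)))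

theorem measurable_assemble : Measurable fun z : (ℝ × EuclideanSpace ℝ (LastNbr G)) ×
    Matrix (Fin n) (Fin n) ℝ => assemble G z.1.1 z.1.2 z.2 := by
  have he (i : Fin n) : Measurable fun z : (ℝ × EuclideanSpace ℝ (LastNbr G)) ×
      Matrix (Fin n) (Fin n) ℝ => extend12 G z.1.2 i := by
    unfold extend12
    split_ifs
    · fun_prop
    · exact measurable_const
  have hS (i j : Fin n) : Measurable fun z : (ℝ × EuclideanSpace ℝ (LastNbr G)) ×
      Matrix (Fin n) (Fin n) ℝ => z.2 i j :=
    (measurable_pi_apply j).comp ((measurable_pi_apply i).comp measurable_snd)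
  refine measurable_pi_iff.2 fun i => measurable_pi_iff.2 fun j => ?_
  refine Fin.lastCases ?_ (fun i => ?_) i <;> refine Fin.lastCases ?_ (fun j => ?_) j
  · simpa using measurable_fst.fst
  · simpa using he j
  · simpa using he i
  · simp only [assemble_castSucc_castSucc]
    exact (hS i j).add (((he i).mul (he j)).div measurable_fst.fst)

variable (δ : ℝ) (D : Matrix (Fin (n + 1)) (Fin (n + 1)) ℝ)

open scoped MatrixOrder in
/-- The Gaussian distributions `law12 G D t`, `t ≥ 0`, as a Markov kernel. -/
noncomputable def law12Kernel : Kernel ℝ (EuclideanSpace ℝ (LastNbr G)) where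
  toFun t := (stdGaussian (EuclideanSpace ℝ (LastNbr G))).map fun x =>
    WithLp.toLp 2 (-(t • ((tilde11 G D)⁻¹.mulVec (tilde12 G D)))) +
      √t • Matrix.toEuclideanCLM (𝕜 := ℝ) (CFC.sqrt (tilde11 G D)⁻¹) x
  measurable' := by
    have h : Measurable fun z : ℝ × EuclideanSpace ℝ (LastNbr G) =>
        WithLp.toLp 2 (-(z.1 • ((tilde11 G D)⁻¹.mulVec (tilde12 G D)))) +
          √z.1 • Matrix.toEuclideanCLM (𝕜 := ℝ) (CFC.sqrt (tilde11 G D)⁻¹) z.2 := by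
      fun_prop
    have h2 := (Measure.measurable_map _ h).comp (Measurable.map_prodMk_left
      (α := ℝ) (ν := stdGaussian (EuclideanSpace ℝ (LastNbr G))))
    convert h2 using 2 with t
    simp only [Function.comp_apply]
    rw [Measure.map_map h measurable_prodMk_left]
    rfl

instance : IsMarkovKernel (law12Kernel G D) :=
  ⟨fun _ => Measure.isProbabilityMeasure_map (Measurable.aemeasurable (by fun_prop))⟩

-- Uniqueness of the positive root gives $\sqrt{tA}=\sqrt t\,\sqrt A$. With $\sqrt t$ taken out,
-- measurability of the kernel in $t$ is evident.
open scoped MatrixOrder in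
theorem law12Kernel_apply {D : Matrix (Fin (n + 1)) (Fin (n + 1)) ℝ} (hD : D.PosDef) {t : ℝ}
    (ht : 0 ≤ t) : law12Kernel G D t = law12 G D t := by
  have hA : 0 ≤ (tilde11 G D)⁻¹ := (posDef_tilde11 G hD).inv.posSemidef.nonneg
  have h : CFC.sqrt (t • (tilde11 G D)⁻¹) = √t • CFC.sqrt (tilde11 G D)⁻¹ := by
    refine CFC.sqrt_unique ?_ (smul_nonneg (Real.sqrt_nonneg t) (CFC.sqrt_nonneg _))
    rw [Matrix.smul_mul, Matrix.mul_smul, smul_smul, Real.mul_self_sqrt ht,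
      CFC.sqrt_mul_sqrt_self _ hA]
  rw [law12, multivariateGaussian, h]
  simp [law12Kernel]

theorem ae_law22_pos : ∀ᵐ t ∂law22 G δ D, 0 < t := by
  rw [law22, gammaMeasure, ae_withDensity_iff (by unfold gammaPDF; fun_prop)]
  have h : ∀ᵐ t : ℝ, t ≠ 0 := by simp [ae_iff]
  filter_upwards [h] with t ht h0
  by_contra hn
  exact h0 (gammaPDF_of_neg (lt_of_le_of_ne (not_lt.1 hn) ht))

variable {δ D}

theorem isProbabilityMeasure_law22 (hδ : 0 < δ) (hD : D.PosDef) :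
    IsProbabilityMeasure (law22 G δ D) :=
  isProbabilityMeasure_gammaMeasure (by positivity) (rate22_pos G hD)

/-- The gamma law charges only $t>0$, so almost sure agreement of `law12` with the kernel is enough.
-/
theorem bind_law12 (δ : ℝ) (hD : D.PosDef) :
    ((law22 G δ D).bind fun t => (law12 G D t).map fun q => (t, q)) =
      law22 G δ D ⊗ₘ law12Kernel G D := by
  have : SFinite (law22 G δ D) := by unfold law22 gammaMeasure; infer_instance
  rw [Measure.compProd_eq_comp_prod]
  refine Measure.bind_congr_right ?_
  filter_upwards [ae_law22_pos G δ D] with t ht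
  rw [Kernel.prod_apply, Kernel.id_apply, Measure.dirac_prod, law12Kernel_apply G hD ht.le]

theorem threeSteps_eq (δ : ℝ) (hD : D.PosDef) (ν : Measure (Matrix (Fin n) (Fin n) ℝ)) :
    threeSteps G δ D ν = ((law22 G δ D ⊗ₘ law12Kernel G D).prod ν).map
      fun z => assemble G z.1.1 z.1.2 z.2 := by
  rw [threeSteps, bind_law12 G δ hD]

theorem lintegral_threeSteps (δ : ℝ) (hD : D.PosDef) (ν : Measure (Matrix (Fin n) (Fin n) ℝ))
    [SFinite ν] {f : Matrix (Fin (n + 1)) (Fin (n + 1)) ℝ → ENNReal} (hf : Measurable f) :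
    ∫⁻ Q, f Q ∂threeSteps G δ D ν =
      ∫⁻ t, ∫⁻ q, ∫⁻ S, f (assemble G t q S) ∂ν ∂law12Kernel G D t ∂law22 G δ D := by
  have : SFinite (law22 G δ D) := by unfold law22 gammaMeasure; infer_instance
  have hm : Measurable fun z : (ℝ × EuclideanSpace ℝ (LastNbr G)) × Matrix (Fin n) (Fin n) ℝ =>
      f (assemble G z.1.1 z.1.2 z.2) := hf.comp (measurable_assemble G)
  rw [threeSteps_eq G δ hD, lintegral_map hf (measurable_assemble G),
    lintegral_prod _ hm.aemeasurable, Measure.lintegral_compProd hm.lintegral_prod_right']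

end Kernels

/-! ### Factorisation of the density and of the measure. -/

section Factorization

variable {n : ℕ} (G : SimpleGraph (Fin (n + 1))) (δ : ℝ)
  (D : Matrix (Fin (n + 1)) (Fin (n + 1)) ℝ)

/-- The factor of the density that depends on the last row and column only. -/
noncomputable def lastWeight (t : ℝ) (q : EuclideanSpace ℝ (LastNbr G)) : ENNReal :=
  if 0 < t then ENNReal.ofReal (t ^ (δ / 2 - 1) * Real.exp (-(1 / 2) *
    (q.ofLp ⬝ᵥ (tilde11 G D).mulVec q.ofLp / t + 2 * (q.ofLp ⬝ᵥ tilde12 G D) + t * block22 D)))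
  else 0

/-- The density of `law12 G D t`. -/
noncomputable def law12PDF (t : ℝ) (q : EuclideanSpace ℝ (LastNbr G)) : ENNReal :=
  ENNReal.ofReal ((√(2 * Real.pi))⁻¹ ^ Fintype.card (LastNbr G) *
    (√(t • (tilde11 G D)⁻¹).det)⁻¹ *
    Real.exp (-((q.ofLp + t • (tilde11 G D)⁻¹.mulVec (tilde12 G D)) ⬝ᵥ
      (t • (tilde11 G D)⁻¹)⁻¹.mulVec
        (q.ofLp + t • (tilde11 G D)⁻¹.mulVec (tilde12 G D))) / 2))

/-- The quotient of the normalising constants for `G` and for `G` without its last node. -/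
noncomputable def constRatio : ℝ :=
  Real.Gamma ((δ + ((G.neighborSet (Fin.last n)).ncard : ℝ)) / 2) /
    rate22 G D ^ ((δ + ((G.neighborSet (Fin.last n)).ncard : ℝ)) / 2) *
    (√(2 * Real.pi) ^ Fintype.card (LastNbr G) * √(tilde11 G D)⁻¹.det)

variable {δ D}

theorem constRatio_pos (hδ : 0 < δ) (hD : D.PosDef) : 0 < constRatio G δ D := by
  have h1 := rate22_pos G hD
  have h2 := (posDef_tilde11 G hD).inv.det_pos
  have h3 : 0 < Real.Gamma ((δ + ((G.neighborSet (Fin.last n)).ncard : ℝ)) / 2) :=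
    Real.Gamma_pos_of_pos (by positivity)
  unfold constRatio
  have := Real.sqrt_pos.2 h2
  positivity

theorem law12_eq_withDensity (hD : D.PosDef) {t : ℝ} (ht : 0 < t) :
    law12 G D t = volume.withDensity (law12PDF G D t) := by
  rw [law12, multivariateGaussian_eq_withDensity _ ((posDef_tilde11 G hD).inv.smul ht)]
  congr 1
  ext q
  simp [law12PDF]

theorem measurable_law12PDF (t : ℝ) : Measurable (law12PDF G D t) := by
  unfold law12PDF
  have h : Continuous fun q : EuclideanSpace ℝ (LastNbr G) =>
      (q.ofLp + t • (tilde11 G D)⁻¹.mulVec (tilde12 G D)) ⬝ᵥ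
      (t • (tilde11 G D)⁻¹)⁻¹.mulVec
        (q.ofLp + t • (tilde11 G D)⁻¹.mulVec (tilde12 G D)) := by fun_prop
  have := h.measurable
  fun_prop

/-- The Gaussian normalisation contains $|t\tilde D_{11}^{-1}|^{-1/2}$, hence $t^{-k/2}$ with
$k=|\partial p|$. Compensating for it raises the gamma shape from $\delta/2$ to $(\delta+k)/2$. At
$t=0$ the conventional values of the densities can break the identity. -/
theorem lastWeight_eq (hδ : 0 < δ) (hD : D.PosDef) {t : ℝ} (ht : t ≠ 0)
    (q : EuclideanSpace ℝ (LastNbr G)) :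
    lastWeight G δ D t q = ENNReal.ofReal (constRatio G δ D) *
      (gammaPDF ((δ + ((G.neighborSet (Fin.last n)).ncard : ℝ)) / 2) (rate22 G D) t *
        law12PDF G D t q) := by
  rcases lt_or_gt_of_ne ht with h | h
  · rw [gammaPDF_of_neg h, lastWeight, if_neg h.not_gt]; simp
  have hr := rate22_pos G hD
  have hdet := (posDef_tilde11 G hD).inv.det_pos
  have hC := constRatio_pos G hδ hD
  rw [lastWeight, if_pos h, gammaPDF_of_nonneg h.le, law12PDF, complete_square G hD ht,
    ← ENNReal.ofReal_mul, ← ENNReal.ofReal_mul hC.le]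
  swap
  · have : 0 < Real.Gamma ((δ + ((G.neighborSet (Fin.last n)).ncard : ℝ)) / 2) :=
      Real.Gamma_pos_of_pos (by positivity)
    positivity
  congr 1
  rw [constRatio, ncard_neighborSet_last]
  set k := Fintype.card (LastNbr G) with hk
  set a : ℝ := (δ + (k : ℝ)) / 2 with ha
  set A : ℝ := (q.ofLp + t • (tilde11 G D)⁻¹.mulVec (tilde12 G D)) ⬝ᵥ
      (t • (tilde11 G D)⁻¹)⁻¹.mulVec
        (q.ofLp + t • (tilde11 G D)⁻¹.mulVec (tilde12 G D))
  have ha0 : 0 < a := by positivity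
  have hΓ := (Real.Gamma_pos_of_pos ha0).ne'
  have hra := (Real.rpow_pos_of_pos hr a).ne'
  have hexp : Real.exp (-(1 / 2) * (A + 2 * (rate22 G D * t))) =
      Real.exp (-(rate22 G D * t)) * Real.exp (-A / 2) := by
    rw [← Real.exp_add]; congr 1; ring
  have hs : √(t • (tilde11 G D)⁻¹).det = t ^ ((k : ℝ) / 2) * √(tilde11 G D)⁻¹.det := by
    rw [Matrix.det_smul, Real.sqrt_mul (by positivity), Real.sqrt_eq_rpow, ← Real.rpow_natCast,
      ← Real.rpow_mul h.le]
    congr 2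
    ring
  have hp : t ^ (a - 1) = t ^ (δ / 2 - 1) * t ^ ((k : ℝ) / 2) := by
    rw [← Real.rpow_add h]; congr 1; rw [ha]; ring
  have hk0 := (Real.rpow_pos_of_pos h ((k : ℝ) / 2)).ne'
  have hsd := (Real.sqrt_pos.2 hdet).ne'
  have hpi : √(2 * Real.pi) ≠ 0 := (Real.sqrt_pos.2 (by positivity)).ne'
  rw [hexp, hs, hp, inv_pow]
  have hpik := pow_ne_zero k hpi
  field_simp

theorem density_assemble (hG : IsPerfectlyOrdered G) (hD : D.PosDef) (t : ℝ)
    (q : EuclideanSpace ℝ (LastNbr G)) (s : FreeParam (dropLast G) → ℝ) :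
    density G δ D (assemble G t q (toMatrix (dropLast G) s)) = lastWeight G δ D t q *
      density (dropLast G) δ (block11 D) (toMatrix (dropLast G) s) := by
  classical
  have hmem : assemble G t q (toMatrix (dropLast G) s) ∈ precisionCone G ↔
      0 < t ∧ toMatrix (dropLast G) s ∈ precisionCone (dropLast G) := by
    rw [← toMatrix_joinParam G hG, toMatrix_mem_precisionCone, toMatrix_joinParam G hG,
      posDef_assemble_iff, toMatrix_mem_precisionCone]
  simp only [density, Set.indicator_apply, hmem, lastWeight]
  by_cases ht : 0 < t
  swap
  · simp [ht]
  by_cases hS : toMatrix (dropLast G) s ∈ precisionCone (dropLast G)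
  swap
  · simp [hS]
  simp only [ht, hS, and_self, if_true]
  have hS0 := hS.1.det_pos
  rw [← ENNReal.ofReal_mul (by positivity), det_assemble G ht.ne', Real.mul_rpow ht.le hS0.le,
    trace_assemble_mul G t q _ hD.isHermitian, mul_add, Real.exp_add]
  congr 1
  ring

theorem unnormalized_eq_smul_threeSteps (hG : IsPerfectlyOrdered G) (hδ : 0 < δ)
    (hD : D.PosDef) :
    unnormalized G δ D = ENNReal.ofReal (constRatio G δ D) •
      threeSteps G δ D (unnormalized (dropLast G) δ (block11 D)) := by
  refine Measure.ext_of_lintegral _ fun f hf => ?_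
  set ν := unnormalized (dropLast G) δ (block11 D) with hν
  have hfa : Measurable fun z : (ℝ × EuclideanSpace ℝ (LastNbr G)) × Matrix (Fin n) (Fin n) ℝ =>
      f (assemble G z.1.1 z.1.2 z.2) := hf.comp (measurable_assemble G)
  have hfa' (t q) : Measurable fun S => f (assemble G t q S) :=
    hfa.comp (measurable_prodMk_left (x := (t, q)))
  set H : ℝ × EuclideanSpace ℝ (LastNbr G) → ENNReal :=
    fun z => ∫⁻ S, f (assemble G z.1 z.2 S) ∂ν with hH
  have hHm : Measurable H := hfa.lintegral_prod_right'
  have hmat := measurable_toMatrix G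
  have hF : Measurable fun x => density G δ D (toMatrix G x) * f (toMatrix G x) :=
    ((measurable_density G δ D).comp hmat).mul (hf.comp hmat)
  have hleft : ∫⁻ Q, f Q ∂unnormalized G δ D =
      ∫⁻ t, ∫⁻ q, lastWeight G δ D t q * H (t, q) := by
    rw [lintegral_unnormalized G δ D hf, lintegral_freeParam G hF]
    refine lintegral_congr fun t => lintegral_congr fun q => ?_
    -- Translation invariance of Lebesgue measure replaces $Q_{11}$ by the Schur complement.
    rw [← lintegral_add_right_eq_self _ (outerParam G t q), hH]
    simp only [toMatrix_joinParam G hG, density_assemble G hG hD, mul_assoc]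
    rw [hν, lintegral_unnormalized _ _ _ (hfa' t q), lintegral_const_mul]
    exact ((measurable_density _ _ _).comp (measurable_toMatrix _)).mul
      ((hfa' t q).comp (measurable_toMatrix _))
  have hK : Measurable fun t => ∫⁻ q, H (t, q) ∂law12Kernel G D t :=
    hHm.lintegral_kernel_prod_right'
  have hγ : Measurable (gammaPDF ((δ + ((G.neighborSet (Fin.last n)).ncard : ℝ)) / 2)
      (rate22 G D)) := by unfold gammaPDF; fun_prop
  rw [hleft, lintegral_smul_measure, lintegral_threeSteps G δ hD ν hf, law22, gammaMeasure,
    lintegral_withDensity_eq_lintegral_mul _ hγ hK, smul_eq_mul,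
    ← lintegral_const_mul _ (hγ.mul hK)]
  have h0 : ∀ᵐ t : ℝ, t ≠ 0 := by simp [ae_iff]
  refine lintegral_congr_ae ?_
  filter_upwards [h0] with t ht
  have hHt : Measurable fun q => H (t, q) := hHm.comp measurable_prodMk_left
  simp only [Pi.mul_apply, lastWeight_eq G hδ hD ht]
  -- For $t<0$ the gamma density is zero, so the value of the kernel there is irrelevant.
  rcases lt_or_gt_of_ne ht with h | h
  · simp [gammaPDF_of_neg h]
  rw [law12Kernel_apply G hD h.le, law12_eq_withDensity G hD h,
    lintegral_withDensity_eq_lintegral_mul _ (measurable_law12PDF G t) hHt, ← mul_assoc,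
    ← lintegral_const_mul _ ((measurable_law12PDF G t).mul hHt)]
  refine lintegral_congr fun q => ?_
  simp only [Pi.mul_apply]
  ring

end Factorization

/-! ### Finite mass and exactness of the samplers, by induction on the nodes. -/

section Normalization

theorem IsPerfectlyOrdered.dropLast {n : ℕ} {G : SimpleGraph (Fin (n + 1))}
    (hG : IsPerfectlyOrdered G) : IsPerfectlyOrdered (dropLast G) := by
  intro i a ha b hb hab
  exact hG i.castSucc (x := a.castSucc) ⟨ha.1, Fin.castSucc_lt_castSucc_iff.2 ha.2⟩
    (y := b.castSucc) ⟨hb.1, Fin.castSucc_lt_castSucc_iff.2 hb.2⟩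
    fun h => hab (Fin.castSucc_injective n h)

/-- Base of the induction: the parameter space is one point of mass one, and the empty matrix has
determinant one and trace zero. -/
theorem unnormalized_univ_of_isEmpty {V : Type*} [Fintype V] [DecidableEq V] [IsEmpty V]
    (G : SimpleGraph V) (δ : ℝ) (D : Matrix V V ℝ) : unnormalized G δ D Set.univ = 1 := by
  have hE : IsEmpty (FreeParam G) := by
    have : IsEmpty G.edgeSet := ⟨fun e => by
      obtain ⟨e, he⟩ := e
      induction e with | _ a b
      exact isEmptyElim a⟩
    exact inferInstanceAs (IsEmpty (V ⊕ G.edgeSet))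
  have hd (Q : Matrix V V ℝ) : density G δ D Q = 1 := by
    have hQ : Q ∈ precisionCone G := by
      rw [Subsingleton.elim Q 1]
      exact ⟨Matrix.PosDef.one, fun i => isEmptyElim i⟩
    rw [density, Set.indicator_of_mem hQ]
    simp [Matrix.trace]
  have h := lintegral_unnormalized G δ D (f := fun _ => 1) measurable_const
  simp only [hd, mul_one, lintegral_one] at h
  rw [h, volume_pi, Measure.pi_of_empty _ 0]
  simp

theorem gWishart_eq_of_unnormalized_eq_smul {V : Type*} [Fintype V] [DecidableEq V]
    {G : SimpleGraph V} {δ : ℝ} {D : Matrix V V ℝ} {c : ENNReal} (hc : c ≠ 0) (hc' : c ≠ ⊤)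
    {ρ : Measure (Matrix V V ℝ)} [IsProbabilityMeasure ρ] (h : unnormalized G δ D = c • ρ) :
    gWishart G δ D = ρ := by
  rw [gWishart, h]
  simp [smul_smul, ENNReal.inv_mul_cancel hc hc']

theorem isProbabilityMeasure_gWishart_of_mass {V : Type*} [Fintype V] [DecidableEq V]
    {G : SimpleGraph V} {δ : ℝ} {D : Matrix V V ℝ} (h0 : unnormalized G δ D Set.univ ≠ 0)
    (h : unnormalized G δ D Set.univ ≠ ⊤) : IsProbabilityMeasure (gWishart G δ D) :=
  ⟨by simp [gWishart, ENNReal.inv_mul_cancel h0 h]⟩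

variable {n : ℕ} (G : SimpleGraph (Fin (n + 1))) {δ : ℝ}
  {D : Matrix (Fin (n + 1)) (Fin (n + 1)) ℝ}

theorem isProbabilityMeasure_threeSteps (hδ : 0 < δ) (hD : D.PosDef)
    (ν : Measure (Matrix (Fin n) (Fin n) ℝ)) [IsProbabilityMeasure ν] :
    IsProbabilityMeasure (threeSteps G δ D ν) := by
  have := isProbabilityMeasure_law22 G hδ hD
  rw [threeSteps_eq G δ hD]
  exact Measure.isProbabilityMeasure_map (measurable_assemble G).aemeasurable

theorem unnormalized_eq_smul_threeSteps_gWishart (hG : IsPerfectlyOrdered G) (hδ : 0 < δ)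
    (hD : D.PosDef)
    (h0 : unnormalized (dropLast G) δ (block11 D) Set.univ ≠ 0)
    (h : unnormalized (dropLast G) δ (block11 D) Set.univ ≠ ⊤) :
    unnormalized G δ D = (ENNReal.ofReal (constRatio G δ D) *
      unnormalized (dropLast G) δ (block11 D) Set.univ) •
      threeSteps G δ D (gWishart (dropLast G) δ (block11 D)) := by
  have hW : unnormalized (dropLast G) δ (block11 D) =
      unnormalized (dropLast G) δ (block11 D) Set.univ •
        gWishart (dropLast G) δ (block11 D) := by
    rw [gWishart, smul_smul, ENNReal.mul_inv_cancel h0 h, one_smul]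
  have := isProbabilityMeasure_gWishart_of_mass h0 h
  have := isProbabilityMeasure_law22 G hδ hD
  rw [unnormalized_eq_smul_threeSteps G hG hδ hD, mul_smul]
  conv_lhs => rw [hW, threeSteps_eq G δ hD, Measure.prod_smul_right, Measure.map_smul,
    ← threeSteps_eq G δ hD]

/-- Each added node multiplies the mass by `constRatio`, which is positive and finite. -/
theorem unnormalized_univ_ne_zero_and_ne_top {δ : ℝ} (hδ : 0 < δ) : ∀ {m : ℕ}
    (G : SimpleGraph (Fin m)) (_ : IsPerfectlyOrdered G) (D : Matrix (Fin m) (Fin m) ℝ),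
    D.PosDef → unnormalized G δ D Set.univ ≠ 0 ∧ unnormalized G δ D Set.univ ≠ ⊤
  | 0, G, _, D, _ => by simp [unnormalized_univ_of_isEmpty]
  | n + 1, G, hG, D, hD => by
    obtain ⟨h0, h⟩ := unnormalized_univ_ne_zero_and_ne_top hδ (dropLast G) hG.dropLast
      (block11 D) (posDef_block11 hD)
    have := isProbabilityMeasure_gWishart_of_mass h0 h
    have := isProbabilityMeasure_threeSteps G hδ hD (gWishart (dropLast G) δ (block11 D))
    have hC := constRatio_pos G hδ hD
    rw [unnormalized_eq_smul_threeSteps_gWishart G hG hδ hD h0 h]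
    simp only [Measure.smul_apply, measure_univ, smul_eq_mul, mul_one]
    exact ⟨mul_ne_zero (ENNReal.ofReal_pos.2 hC).ne' h0, ENNReal.mul_ne_top ENNReal.ofReal_ne_top h⟩

theorem isProbabilityMeasure_gWishart {m : ℕ} {G : SimpleGraph (Fin m)}
    (hG : IsPerfectlyOrdered G) (hδ : 0 < δ) {D : Matrix (Fin m) (Fin m) ℝ} (hD : D.PosDef) :
    IsProbabilityMeasure (gWishart G δ D) :=
  have h := unnormalized_univ_ne_zero_and_ne_top hδ G hG D hD
  isProbabilityMeasure_gWishart_of_mass h.1 h.2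

theorem threeSteps_gWishart (hG : IsPerfectlyOrdered G) (hδ : 0 < δ) (hD : D.PosDef) :
    threeSteps G δ D (gWishart (dropLast G) δ (block11 D)) = gWishart G δ D := by
  obtain ⟨h0, h⟩ := unnormalized_univ_ne_zero_and_ne_top hδ (dropLast G) hG.dropLast
    (block11 D) (posDef_block11 hD)
  have := isProbabilityMeasure_gWishart_of_mass h0 h
  have := isProbabilityMeasure_threeSteps G hδ hD (gWishart (dropLast G) δ (block11 D))
  have hC := constRatio_pos G hδ hD
  exact (gWishart_eq_of_unnormalized_eq_smul (mul_ne_zero (ENNReal.ofReal_pos.2 hC).ne' h0)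
    (ENNReal.mul_ne_top ENNReal.ofReal_ne_top h)
    (unnormalized_eq_smul_threeSteps_gWishart G hG hδ hD h0 h)).symm

/-- With no lower nodes only the gamma draw remains; this identifies the base case of the recursion
with an instance of the three steps. -/
theorem threeSteps_one_node (G : SimpleGraph (Fin 1)) {D : Matrix (Fin 1) (Fin 1) ℝ}
    (hD : D.PosDef) (ν : Measure (Matrix (Fin 0) (Fin 0) ℝ)) [IsProbabilityMeasure ν] :
    threeSteps G δ D ν = (gammaMeasure (δ / 2) (D 0 0 / 2)).map fun t => Matrix.of fun _ _ => t := by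
  have hE : IsEmpty (LastNbr G) := ⟨fun i => i.1.elim0⟩
  have hlaw : law22 G δ D = gammaMeasure (δ / 2) (D 0 0 / 2) := by
    simp [law22, rate22, block22]
  have hmeas : Measurable fun t : ℝ => (Matrix.of fun _ _ => t : Matrix (Fin 1) (Fin 1) ℝ) :=
    measurable_pi_iff.2 fun _ => measurable_pi_iff.2 fun _ => measurable_id
  refine Measure.ext_of_lintegral _ fun f hf => ?_
  rw [lintegral_threeSteps G δ hD ν hf, hlaw, lintegral_map hf hmeas]
  have ha (t q S) : assemble G t q S = Matrix.of fun _ _ => t := by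
    ext i j
    have hlast (k : Fin (0 + 1)) : k = Fin.last 0 := Fin.ext (by simp)
    rw [hlast i, hlast j, assemble_last_last]
    rfl
  simp [ha]

theorem recursiveSampler_eq_gWishart (hδ : 0 < δ) : ∀ {n : ℕ} (G : SimpleGraph (Fin (n + 1)))
    (_ : IsPerfectlyOrdered G) (D : Matrix (Fin (n + 1)) (Fin (n + 1)) ℝ),
    D.PosDef → recursiveSampler n G δ D = gWishart G δ D
  | 0, G, hG, D, hD => by
    have := isProbabilityMeasure_gWishart hG.dropLast hδ (posDef_block11 hD)
    rw [← threeSteps_gWishart G hG hδ hD, threeSteps_one_node G hD, recursiveSampler]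
  | n + 1, G, hG, D, hD => by
    rw [recursiveSampler, recursiveSampler_eq_gWishart hδ (dropLast G) hG.dropLast _
      (posDef_block11 hD), threeSteps_gWishart G hG hδ hD]

end Normalization

/-! ### Marginal laws and independence. -/

section Laws

variable {n : ℕ} (G : SimpleGraph (Fin (n + 1)))

theorem measurable_entry {m k : Type*} (i : m) (j : k) :
    Measurable fun Q : Matrix m k ℝ => Q i j :=
  (measurable_pi_apply j).comp (measurable_pi_apply i)

theorem measurable_block22 : Measurable (block22 (n := n)) := measurable_entry _ _

theorem measurable_block12 : Measurable (block12 (n := n)) :=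
  measurable_pi_iff.2 fun _ => measurable_entry _ _

theorem measurable_schur11 : Measurable (schur11 (n := n)) := by
  refine measurable_pi_iff.2 fun i => measurable_pi_iff.2 fun j => ?_
  exact (measurable_entry _ _).sub (measurable_block22.inv.mul
    ((measurable_entry i.castSucc _).mul (measurable_entry j.castSucc _)))

theorem measurable_free12 : Measurable (free12 G) :=
  (WithLp.measurable_toLp 2 _).comp (measurable_pi_iff.2 fun _ => measurable_entry _ _)

theorem measurable_extend12 : Measurable (extend12 G) := by
  refine measurable_pi_iff.2 fun i => ?_
  unfold extend12
  split_ifs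
  · fun_prop
  · exact measurable_const

variable {δ : ℝ} {D : Matrix (Fin (n + 1)) (Fin (n + 1)) ℝ}

/-- Laws under the G-Wishart measure become laws under a product measure whose coordinates are
$(q_{22},\tilde q_{12})$ and $Q_{11}^\star$. -/
theorem map_gWishart (hG : IsPerfectlyOrdered G) (hδ : 0 < δ) (hD : D.PosDef) {α : Type*}
    [MeasurableSpace α] {g : Matrix (Fin (n + 1)) (Fin (n + 1)) ℝ → α} (hg : Measurable g) :
    (gWishart G δ D).map g = ((law22 G δ D ⊗ₘ law12Kernel G D).prod
      (gWishart (dropLast G) δ (block11 D))).map fun z => g (assemble G z.1.1 z.1.2 z.2) := by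
  rw [← threeSteps_gWishart G hG hδ hD, threeSteps_eq G δ hD,
    Measure.map_map hg (measurable_assemble G)]
  rfl

theorem map_schur11_gWishart (hG : IsPerfectlyOrdered G) (hδ : 0 < δ) (hD : D.PosDef) :
    (gWishart G δ D).map schur11 = gWishart (dropLast G) δ (block11 D) := by
  have := isProbabilityMeasure_law22 G hδ hD
  have := isProbabilityMeasure_gWishart hG.dropLast hδ (posDef_block11 hD)
  rw [map_gWishart G hG hδ hD measurable_schur11]
  simp only [schur11_assemble]
  rw [Measure.map_snd_prod]
  simp

theorem map_block22_free12_gWishart (hG : IsPerfectlyOrdered G) (hδ : 0 < δ) (hD : D.PosDef) :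
    (gWishart G δ D).map (fun Q => (block22 Q, free12 G Q)) =
      law22 G δ D ⊗ₘ law12Kernel G D := by
  have := isProbabilityMeasure_law22 G hδ hD
  have := isProbabilityMeasure_gWishart hG.dropLast hδ (posDef_block11 hD)
  rw [map_gWishart G hG hδ hD (measurable_block22.prodMk (measurable_free12 G))]
  simp only [block22_assemble, free12_assemble, Prod.mk.eta]
  rw [Measure.map_fst_prod]
  simp

theorem map_block22_gWishart (hG : IsPerfectlyOrdered G) (hδ : 0 < δ) (hD : D.PosDef) :
    (gWishart G δ D).map block22 = law22 G δ D := by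
  have := isProbabilityMeasure_law22 G hδ hD
  have h := congrArg Measure.fst (map_block22_free12_gWishart G hG hδ hD)
  rwa [Measure.fst_compProd, Measure.fst_map_prodMk (measurable_free12 G)] at h

theorem indepFun_schur11_gWishart (hG : IsPerfectlyOrdered G) (hδ : 0 < δ) (hD : D.PosDef) :
    IndepFun schur11 (fun Q => (block12 Q, block22 Q)) (gWishart G δ D) := by
  have := isProbabilityMeasure_law22 G hδ hD
  have := isProbabilityMeasure_gWishart hG hδ hD
  have := isProbabilityMeasure_gWishart hG.dropLast hδ (posDef_block11 hD)
  have hm : Measurable fun z : ℝ × EuclideanSpace ℝ (LastNbr G) => (extend12 G z.2, z.1) :=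
    ((measurable_extend12 G).comp measurable_snd).prodMk measurable_fst
  have h2 := measurable_block12.prodMk (measurable_block22 (n := n))
  have h := (indepFun_prod (μ := law22 G δ D ⊗ₘ law12Kernel G D)
    (ν := gWishart (dropLast G) δ (block11 D)) hm measurable_id).symm
  replace h := (indepFun_iff_map_prod_eq_prod_map_map (by fun_prop)
    (hm.comp measurable_fst).aemeasurable).1 h
  rw [indepFun_iff_map_prod_eq_prod_map_map measurable_schur11.aemeasurable h2.aemeasurable,
    map_gWishart G hG hδ hD (measurable_schur11.prodMk h2), map_gWishart G hG hδ hD h2,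
    map_gWishart G hG hδ hD measurable_schur11]
  simpa [Function.comp_def] using h

end Laws

end GWishart

open GWishart
theorem mainTheorem3 (n : ℕ) (G : SimpleGraph (Fin (n + 1))) (hG : IsPerfectlyOrdered G)
    (δ : ℝ) (hδ : 0 < δ) (D : Matrix (Fin (n + 1)) (Fin (n + 1)) ℝ) (hD : D.PosDef) :
    IsProbabilityMeasure (gWishart G δ D) ∧
    0 < rate22 G D ∧
    (∀ {Ω : Type*} [MeasurableSpace Ω] (μ : Measure Ω) [IsProbabilityMeasure μ]
      (Q : Ω → Matrix (Fin (n + 1)) (Fin (n + 1)) ℝ), HasLaw Q (gWishart G δ D) μ →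
        IndepFun (fun ω => schur11 (Q ω)) (fun ω => (block12 (Q ω), block22 (Q ω))) μ ∧
        HasLaw (fun ω => schur11 (Q ω)) (gWishart (dropLast G) δ (block11 D)) μ ∧
        HasLaw (fun ω => block22 (Q ω)) (law22 G δ D) μ ∧
        ∀ᵐ t ∂(μ.map fun ω => block22 (Q ω)),
          condDistrib (fun ω => free12 G (Q ω)) (fun ω => block22 (Q ω)) μ t = law12 G D t) ∧
    threeSteps G δ D (gWishart (dropLast G) δ (block11 D)) = gWishart G δ D ∧
    recursiveSampler n G δ D = gWishart G δ D := by
  have hprob := isProbabilityMeasure_gWishart hG hδ hD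
  have := isProbabilityMeasure_law22 G hδ hD
  refine ⟨hprob, rate22_pos G hD, ?_, threeSteps_gWishart G hG hδ hD,
    recursiveSampler_eq_gWishart hδ G hG D hD⟩
  intro Ω _ μ _ Q hQ
  have hmap {α : Type} [MeasurableSpace α] {g : Matrix (Fin (n + 1)) (Fin (n + 1)) ℝ → α}
      (hg : Measurable g) : μ.map (fun ω => g (Q ω)) = (gWishart G δ D).map g := by
    rw [← hQ.map_eq, AEMeasurable.map_map_of_aemeasurable hg.aemeasurable hQ.aemeasurable]
    rfl
  have h22 : μ.map (fun ω => block22 (Q ω)) = law22 G δ D := by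
    rw [hmap measurable_block22, map_block22_gWishart G hG hδ hD]
  have hm12 := measurable_block12.prodMk (measurable_block22 (n := n))
  have hm := measurable_block22.prodMk (measurable_free12 G)
  refine ⟨?_, ⟨measurable_schur11.comp_aemeasurable hQ.aemeasurable, ?_⟩,
    ⟨measurable_block22.comp_aemeasurable hQ.aemeasurable, h22⟩, ?_⟩
  · have h := indepFun_schur11_gWishart G hG hδ hD
    rw [indepFun_iff_map_prod_eq_prod_map_map measurable_schur11.aemeasurable hm12.aemeasurable] at h
    refine (indepFun_iff_map_prod_eq_prod_map_map
      (measurable_schur11.comp_aemeasurable hQ.aemeasurable)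
      (hm12.comp_aemeasurable hQ.aemeasurable)).2 ?_
    simp only [Function.comp_apply]
    rw [hmap (measurable_schur11.prodMk hm12), h]
    exact congrArg₂ Measure.prod (hmap measurable_schur11).symm (hmap hm12).symm
  · rw [hmap measurable_schur11, map_schur11_gWishart G hG hδ hD]
  -- The joint law of $(q_{22},\tilde q_{12})$ is a composition product, and disintegrations are
  -- almost surely unique. Positivity of $t$ then identifies the kernel with the Gaussian law.
  · have hcond := condDistrib_ae_eq_of_measure_eq_compProd (μ := μ) (κ := law12Kernel G D)
      (fun ω => block22 (Q ω)) ((measurable_free12 G).comp_aemeasurable hQ.aemeasurable)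
      (by
        rw [h22, ← map_block22_free12_gWishart G hG hδ hD]
        exact hmap hm)
    have hpos := ae_law22_pos G δ D
    rw [← h22] at hpos
    filter_upwards [hcond, hpos] with t h1 h2
    rw [← law12Kernel_apply G hD h2.le]
    exact h1
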